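/- Let $V$ be an abelian group and let $F$ be a set of endomorphisms of $V$, commuting with each other, such that: $0,1,-1\in F$; $F^*=F\setminus\{0\}$ is a subgroup of $\mathrm{Aut}(V)$; and $F$ acts fixed point free, i.e. if $\alpha x=\beta x$ with $\alpha,\beta\in F$, $x\in V$, then $\alpha=\beta$ or $x=0$. Let $Q(V)$ be the quasi-kernel, i.e. the set of all $u\in V$ such that for all $\alpha,\beta\in F$ there is $\gamma\in F$ with $\alpha u+\beta u=\gamma u$, and assume that $Q(V)$ generates the group $V$. (That is, $(V,F)$ is a commutative near vector space.) Call $u,v\in Q(V)\setminus\{0\}$ compatible if $u+\lambda v\in Q(V)$ for some $\lambda\in F^*$; compatibility is an equivalence relation on $Q(V)\setminus\{0\}$, and the blocks of $V$ are the subgroups of $V$ generated by its equivalence classes. Suppose that $V$ has exactly $n$ blocks, $n\in\mathbb N$, and that each block is infinite. Let $\mathrm{Th}(V)$ be the complete first-order theory of $V$ in the language $\{+,0,(\lambda)_{\lambda\in F}\}$, where each $\lambda\in F$ is a unary function symbol. Then $\mathrm{Th}(V)$ has Morley rank $n$ and Morley degree $1$; that is, in every model of $\mathrm{Th}(V)$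 the formula $x=x$ has Morley rank $n$ and Morley degree $1$. -/

import Mathlib

open scoped FirstOrder

universe u w

/-! ### Near vector spaces -/

namespace NearVectorSpace

variable {V : Type u} [AddCommGroup V]

/-- `(V, F)` is an `F`-group: `F` is a set of endomorphisms of the group `V` containing `0`, `1` and
`-1`, its non-zero elements form a subgroup of the automorphism group of `V` (the unit group
of the endomorphism ring), and `F` acts fixed point free. -/
structure IsFGroup (F : Set (AddMonoid.End V)) : Prop where
  zero_mem : 0 ∈ F
  one_mem : 1 ∈ F
  neg_one_mem : -1 ∈ F
  subgroup : ∃ H : Subgroup (AddMonoid.End V)ˣ,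
    F \ {0} = (fun a : (AddMonoid.End V)ˣ => (a : AddMonoid.End V)) '' (H : Set (AddMonoid.End V)ˣ)
  fixedPointFree : ∀ a ∈ F, ∀ b ∈ F, ∀ x : V, a x = b x → a = b ∨ x = 0

/-- The quasi-kernel `Q(V)`. -/
def quasiKernel (F : Set (AddMonoid.End V)) : Set V :=
  {x | ∀ a ∈ F, ∀ b ∈ F, ∃ c ∈ F, a x + b x = c x}

/-- `(V, F)` is a near vector space: an `F`-group whose quasi-kernel generates `V`. -/
structure IsNearVectorSpace (F : Set (AddMonoid.End V)) : Prop extends IsFGroup F where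
  closure_quasiKernel : AddSubgroup.closure (quasiKernel F) = ⊤

/-- Commutativity of `(F, ∘)`. -/
def IsCommutative (F : Set (AddMonoid.End V)) : Prop :=
  ∀ a ∈ F, ∀ b ∈ F, ∀ x : V, a (b x) = b (a x)

/-- Compatibility of two elements `x`, `y` of the quasi-kernel. -/
def Compatible (F : Set (AddMonoid.End V)) (x y : V) : Prop :=
  ∃ a ∈ F \ {0}, x + a y ∈ quasiKernel F

/-- The block of `x ∈ Q(V) \ {0}`: the subgroup of `V` generated by all the elements of
`Q(V) \ {0}` which are compatible with `x`. -/
def block (F : Set (AddMonoid.End V)) (x : V) : AddSubgroup V :=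
  AddSubgroup.closure {y | y ∈ quasiKernel F \ {0} ∧ Compatible F x y}

/-- The set of all blocks of `(V, F)`. -/
def blocks (F : Set (AddMonoid.End V)) : Set (AddSubgroup V) :=
  {W | ∃ x ∈ quasiKernel F \ {0}, W = block F x}

/-- The function symbols `0`, `+` and `a` for `a ∈ F`, of arity `0`, `2` and `1`. -/
inductive Func (F : Set (AddMonoid.End V)) : ℕ → Type u
  | zero : Func F 0
  | add : Func F 2
  | scalar (a : F) : Func F 1

/-- The language `{+, 0, (a)_{a ∈ F}}` of near vector spaces over `F`. -/
def lang (F : Set (AddMonoid.End V)) : FirstOrder.Language.{u, u} := ⟨Func F, fun _ => PEmpty⟩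

/-- `V` as a structure in the language of near vector spaces over `F`. -/
instance langStructure (F : Set (AddMonoid.End V)) : (lang F).Structure V where
  funMap := fun {_} f => match f with
    | Func.zero => fun _ => 0
    | Func.add => fun v => v 0 + v 1
    | Func.scalar a => fun v => (a : AddMonoid.End V) (v 0)
  RelMap := fun {_} r => PEmpty.elim r

end NearVectorSpace

/-! ### Morley rank and Morley degree -/

namespace MorleyRank

variable {L : FirstOrder.Language.{w, w}} {n : ℕ}

/-- `φ(v, a)` holds in `N`; here `φ` is a formula in `n` variables with parameters in `M`, which are
read in `N` through `f : M → N`. -/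
def Holds {M : Type w} {N : Type w} [L.Structure N] (f : M → N) (φ : L.Formula (M ⊕ Fin n))
    (v : Fin n → N) : Prop :=
  φ.Realize (Sum.elim f v)

/-- `RM(φ) ≥ o`, by recursion on the ordinal `o`, for formulas `φ` in `n` variables with parameters
in an `L`-structure `M`. In the successor step, `N` is an elementary extension of `M`, and the `ψ j`
are formulas with parameters in `N` that define pairwise disjoint subsets of `φ(N)`. -/
noncomputable def RankGE (o : Ordinal.{w}) :
    ∀ (M : Type w) [L.Structure M], L.Formula (M ⊕ Fin n) → Prop :=
  Ordinal.limitRecOn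
    (motive := fun _ => ∀ (M : Type w) [L.Structure M], L.Formula (M ⊕ Fin n) → Prop) o
    (fun M _ φ => ∃ v : Fin n → M, Holds id φ v)
    (fun _ rankGE M _ φ =>
      ∃ (N : Type w) (_ : L.Structure N) (f : M ↪ₑ[L] N) (ψ : ℕ → L.Formula (N ⊕ Fin n)),
        (∀ j v, Holds id (ψ j) v → Holds f φ v) ∧
        (∀ j, rankGE N (ψ j)) ∧
        ∀ i j, i ≠ j → ¬ ∃ v, Holds id (ψ i) v ∧ Holds id (ψ j) v)
    (fun o _ rankGE M _ φ => ∀ d, ∀ hd : d < o, rankGE d hd M φ)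

theorem rankGE_zero (M : Type w) [L.Structure M] (φ : L.Formula (M ⊕ Fin n)) :
    RankGE 0 M φ ↔ ∃ v : Fin n → M, Holds id φ v := by
  simp [RankGE]

theorem rankGE_add_one (o : Ordinal.{w}) (M : Type w) [L.Structure M] (φ : L.Formula (M ⊕ Fin n)) :
    RankGE (o + 1) M φ ↔
      ∃ (N : Type w) (_ : L.Structure N) (f : M ↪ₑ[L] N) (ψ : ℕ → L.Formula (N ⊕ Fin n)),
        (∀ j v, Holds id (ψ j) v → Holds f φ v) ∧
        (∀ j, RankGE o N (ψ j)) ∧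
        ∀ i j, i ≠ j → ¬ ∃ v, Holds id (ψ i) v ∧ Holds id (ψ j) v := by
  unfold RankGE
  rw [Ordinal.limitRecOn_add_one]

theorem rankGE_limit (o : Ordinal.{w}) (ho : Order.IsSuccLimit o) (M : Type w) [L.Structure M]
    (φ : L.Formula (M ⊕ Fin n)) : RankGE o M φ ↔ ∀ d < o, RankGE d M φ := by
  unfold RankGE
  rw [Ordinal.limitRecOn_limit _ _ _ _ ho]

/-- `RM(φ) = o`: `o` is the largest ordinal with `RM(φ) ≥ o`. -/
def HasRank (M : Type w) [L.Structure M] (φ : L.Formula (M ⊕ Fin n)) (o : Ordinal.{w}) : Prop :=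
  IsGreatest {d | RankGE d M φ} o

/-- `RM(φ) = o` and `dM(φ) = d`: `d` is the greatest natural number such that, in some elementary
extension `N` of `M`, there are `d` formulas of rank `o` with parameters in `N` that define
pairwise disjoint subsets of `φ(N)`. -/
def HasRankAndDegree (M : Type w) [L.Structure M] (φ : L.Formula (M ⊕ Fin n)) (o : Ordinal.{w})
    (d : ℕ) : Prop :=
  HasRank M φ o ∧
  IsGreatest {k : ℕ | ∃ (N : Type w) (_ : L.Structure N) (f : M ↪ₑ[L] N)
      (ψ : Fin k → L.Formula (N ⊕ Fin n)),
        (∀ j, HasRank N (ψ j) o) ∧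
        (∀ j v, Holds id (ψ j) v → Holds f φ v) ∧
        ∀ i j, i ≠ j → ¬ ∃ v, Holds id (ψ i) v ∧ Holds id (ψ j) v} d

/-- The formula `x = x` in one variable `x`. -/
def selfEq (L : FirstOrder.Language.{w, w}) (M : Type w) : L.Formula (M ⊕ Fin 1) :=
  FirstOrder.Language.Term.equal (FirstOrder.Language.Term.var (Sum.inr 0))
    (FirstOrder.Language.Term.var (Sum.inr 0))

/-- The theory `T` has Morley rank `o` and Morley degree `d`: the formula `x = x` has Morley rank
`o` and Morley degree `d` in every model of `T`. -/
def TheoryHasRankAndDegree (T : L.Theory) (o : Ordinal.{w}) (d : ℕ) : Prop :=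
  ∀ (M : Type w) [L.Structure M], M ⊨ T → HasRankAndDegree M (selfEq L M) o d

end MorleyRank

/-! Let `R` be the subring of `End V` generated by `F`, a commutative ring. For `q ≠ 0` in the
quasi-kernel, `R q = F q`, so the annihilator of `q` is a maximal ideal. Two such elements are
compatible iff their annihilators agree, hence the `n` blocks correspond to `n` maximal ideals with
zero intersection. By the Chinese remainder theorem `R` is a product of `n` fields, cut out by
idempotents `e i`, and each component `e i • V` is an infinite vector space
(`IsNearVectorSpace.exists_completeOrthogonalIdempotents`).

The scalars are given by terms, so every model of the theory is again an `R`-module with infinite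
components (`IsModuleModel.exists_isModuleModel`). A back-and-forth argument shows that a definable
subset of a model is determined by finitely many affine equations
(`IsModuleStructure.isEquational`).

Rank is measured by cosets of sums of `k` components. On such a coset an affine equation either
holds everywhere or cuts out a set covered by finitely many cosets of fewer components. So a
definable set or its complement is small in the coset, which bounds the rank from above and gives
degree 1 (`IsModuleModel.not_isSmall_of_rankGE`). Splitting off one infinite component at a time
gives the lower bound (`IsModuleModel.rankGE_of_coset_subset`). -/

theorem Ideal.exists_completeOrthogonalIdempotents {R ι : Type*} [CommRing R]
    [Fintype ι] [DecidableEq ι] (I : ι → Ideal R) (hI : ∀ i, (I i).IsMaximal)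
    (hinj : Function.Injective I) (hbot : ∀ r, (∀ i, r ∈ I i) → r = 0) :
    ∃ e : ι → R, CompleteOrthogonalIdempotents e ∧
      (∀ i r, e i * r = 0 ∨ ∃ s, s * r * e i = e i) ∧ ∀ i, 1 - e i ∈ I i := by
  have hco : Pairwise fun i j => IsCoprime (I i) (I j) := fun i j hij => by
    have := hI i
    have := hI j
    exact Ideal.isCoprime_of_isMaximal (hinj.ne hij)
  -- Chinese remainder theorem. Since the `I k` intersect in zero, the identities below are checked
  -- modulo each `I k`.
  have key : ∀ i, ∃ r, ∀ j, r - (if i = j then 1 else 0) ∈ I j := fun i =>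
    Ideal.exists_forall_sub_mem_ideal hco (fun j => if i = j then 1 else 0)
  choose e he using key
  have h1 : ∀ i, e i - 1 ∈ I i := fun i => by simpa using he i i
  have h0 : ∀ i j, i ≠ j → e i ∈ I j := fun i j hij => by simpa [hij] using he i j
  refine ⟨e, CompleteOrthogonalIdempotents.iff_ortho_complete.2 ⟨fun i j hij => ?_, ?_⟩,
    fun i r => ?_, fun i => ?_⟩
  · refine hbot _ fun k => ?_
    by_cases hk : i = k
    · exact (I k).mul_mem_left _ (h0 j k (hk ▸ hij.symm))
    · exact (I k).mul_mem_right _ (h0 i k hk)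
  · refine sub_eq_zero.1 (hbot _ fun k => ?_)
    rw [← Finset.add_sum_erase _ _ (Finset.mem_univ k), add_sub_right_comm]
    exact (I k).add_mem (h1 k) ((I k).sum_mem fun j hj => h0 j k (Finset.ne_of_mem_erase hj))
  · by_cases hr : r ∈ I i
    · refine Or.inl (hbot _ fun k => ?_)
      by_cases hk : i = k
      · exact (I k).mul_mem_left _ (hk ▸ hr)
      · exact (I k).mul_mem_right _ (h0 i k hk)
    · obtain ⟨s, m, hm, hs⟩ := (hI i).exists_inv hr
      refine Or.inr ⟨s, sub_eq_zero.1 (hbot _ fun k => ?_)⟩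
      by_cases hk : i = k
      · have : s * r * e i - e i = - m * e i := by linear_combination e i * hs
        rw [this]
        exact (I k).mul_mem_right _ ((I k).neg_mem (hk ▸ hm))
      · exact (I k).sub_mem ((I k).mul_mem_left _ (h0 i k hk)) (h0 i k hk)
  · simpa using (I i).neg_mem (h1 i)

/-! ### Blocks as maximal ideals of the ring generated by `F` -/

namespace NearVectorSpace

variable {V : Type u} [AddCommGroup V] {F : Set (AddMonoid.End V)}

namespace IsFGroup

theorem mul_mem (hV : IsFGroup F) {a b : AddMonoid.End V} (ha : a ∈ F) (hb : b ∈ F) :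
    a * b ∈ F := by
  obtain ⟨H, hH⟩ := hV.subgroup
  by_cases ha0 : a = 0
  · simpa [ha0] using hV.zero_mem
  by_cases hb0 : b = 0
  · simpa [hb0] using hV.zero_mem
  have ha' : a ∈ F \ {0} := ⟨ha, ha0⟩
  have hb' : b ∈ F \ {0} := ⟨hb, hb0⟩
  rw [hH] at ha' hb'
  obtain ⟨x, hx, rfl⟩ := ha'
  obtain ⟨y, hy, rfl⟩ := hb'
  have : ((x * y : (AddMonoid.End V)ˣ) : AddMonoid.End V) ∈ F \ {0} := by
    rw [hH]; exact ⟨x * y, H.mul_mem hx hy, rfl⟩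
  exact this.1

theorem exists_inv (hV : IsFGroup F) {a : AddMonoid.End V} (ha : a ∈ F) (ha0 : a ≠ 0) :
    ∃ b ∈ F, b * a = 1 := by
  obtain ⟨H, hH⟩ := hV.subgroup
  have ha' : a ∈ F \ {0} := ⟨ha, ha0⟩
  rw [hH] at ha'
  obtain ⟨x, hx, rfl⟩ := ha'
  have : ((x⁻¹ : (AddMonoid.End V)ˣ) : AddMonoid.End V) ∈ F \ {0} := by
    rw [hH]; exact ⟨x⁻¹, H.inv_mem hx, rfl⟩
  exact ⟨_, this.1, by simp⟩

end IsFGroup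

section Scalars

variable {R : Type*} [CommRing R] [Module R V] {σ : F → R}

/-- The definition of the quasi-kernel says exactly that `F q` is closed under addition, so passing
from `F` to the ring it generates does not enlarge the orbit of `q`. -/
theorem exists_apply_eq_smul (hV : IsFGroup F) (hσ : ∀ a x, σ a • x = (a : AddMonoid.End V) x)
    (hgen : Subring.closure (Set.range σ) = ⊤) {q : V} (hq : q ∈ quasiKernel F) (r : R) :
    ∃ a : F, r • q = σ a • q := by
  have hr : r ∈ Subring.closure (Set.range σ) := hgen ▸ Subring.mem_top r
  rw [Subring.mem_closure_iff] at hr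
  induction hr using AddSubgroup.closure_induction with
  | mem x hx =>
    induction hx using Submonoid.closure_induction with
    | mem x hx =>
      obtain ⟨a, rfl⟩ := hx
      exact ⟨a, rfl⟩
    | one => exact ⟨⟨1, hV.one_mem⟩, by rw [hσ, one_smul]; rfl⟩
    | mul x y _ _ hx hy =>
      obtain ⟨a, ha⟩ := hx
      obtain ⟨b, hb⟩ := hy
      refine ⟨⟨a * b, hV.mul_mem a.2 b.2⟩, ?_⟩
      rw [mul_smul, hb, smul_comm, ha, smul_comm, hσ, hσ, hσ]
      rfl
  | zero => exact ⟨⟨0, hV.zero_mem⟩, by rw [hσ, zero_smul]; rfl⟩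
  | add x y _ _ hx hy =>
    obtain ⟨a, ha⟩ := hx
    obtain ⟨b, hb⟩ := hy
    obtain ⟨c, hc, h⟩ := hq a a.2 b b.2
    exact ⟨⟨c, hc⟩, by rw [add_smul, ha, hb, hσ, hσ, hσ, h]⟩
  | neg x _ hx =>
    obtain ⟨a, ha⟩ := hx
    refine ⟨⟨-1 * a, hV.mul_mem hV.neg_one_mem a.2⟩, ?_⟩
    rw [neg_smul, ha, hσ, hσ]
    rfl

theorem eq_of_smul_eq_smul (hV : IsFGroup F) (hσ : ∀ a x, σ a • x = (a : AddMonoid.End V) x)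
    {q : V} (hq : q ≠ 0) {a b : F} (h : σ a • q = σ b • q) : a = b := by
  rw [hσ, hσ] at h
  exact Subtype.ext ((hV.fixedPointFree a a.2 b b.2 q h).resolve_right hq)

theorem isMaximal_torsionOf (hV : IsFGroup F) (hσ : ∀ a x, σ a • x = (a : AddMonoid.End V) x)
    (hgen : Subring.closure (Set.range σ) = ⊤) {q : V} (hq : q ∈ quasiKernel F) (hq0 : q ≠ 0) :
    (Ideal.torsionOf R V q).IsMaximal := by
  rw [Ideal.isMaximal_iff]
  refine ⟨by simpa using hq0, fun J r hJ hr hrJ => ?_⟩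
  obtain ⟨a, ha⟩ := exists_apply_eq_smul hV hσ hgen hq r
  rw [Ideal.mem_torsionOf_iff, ha, hσ] at hr
  have ha0 : (a : AddMonoid.End V) ≠ 0 := fun h => hr (by rw [h]; rfl)
  obtain ⟨b, hb, hba⟩ := hV.exists_inv a.2 ha0
  have h1 : 1 - σ ⟨b, hb⟩ * r ∈ Ideal.torsionOf R V q := by
    rw [Ideal.mem_torsionOf_iff, sub_smul, mul_smul, ha, hσ, hσ, one_smul, sub_eq_zero]
    exact (DFunLike.congr_fun hba q).symm
  simpa using J.add_mem (hJ h1) (J.mul_mem_left (σ ⟨b, hb⟩) hrJ)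

/-- Distinct annihilators are coprime: some `r + s = 1` with `r` killing `q` and `s` killing `q'`.
If `u = q + l q'` lies in the quasi-kernel, then `r • u = c u` with `c ∈ F`; applying `r` gives `c
q' = q'`, hence `c = 1`, while applying `s` gives `c q = 0`. Conversely, with equal annihilators the
same `c` computes `a + b` on `q`, on `q'` and on `q + q'`. -/
theorem compatible_iff_torsionOf_eq (hV : IsFGroup F)
    (hσ : ∀ a x, σ a • x = (a : AddMonoid.End V) x)
    (hgen : Subring.closure (Set.range σ) = ⊤) {q q' : V} (hq : q ∈ quasiKernel F) (hq0 : q ≠ 0)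
    (hq' : q' ∈ quasiKernel F) (hq0' : q' ≠ 0) :
    Compatible F q q' ↔ Ideal.torsionOf R V q = Ideal.torsionOf R V q' := by
  constructor
  · rintro ⟨l, ⟨hl, hl0⟩, hu⟩
    by_contra hne
    have := isMaximal_torsionOf hV hσ hgen hq hq0
    have := isMaximal_torsionOf hV hσ hgen hq' hq0'
    obtain ⟨r, hr, s, hs, hrs⟩ := Ideal.isCoprime_iff_exists.1 (Ideal.isCoprime_of_isMaximal hne)
    rw [Ideal.mem_torsionOf_iff] at hr hs
    obtain ⟨c, hc⟩ := exists_apply_eq_smul hV hσ hgen hu r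
    have hrq' : r • q' = q' := by
      rw [← add_zero (r • q'), ← hs, ← add_smul, hrs, one_smul]
    have hsq : s • q = q := by
      rw [← zero_add (s • q), ← hr, ← add_smul, hrs, one_smul]
    have hinj : ∀ x y : V, l x = l y → x = y := fun x y h => by
      obtain ⟨b, -, hb⟩ := hV.exists_inv hl hl0
      have := congrArg b h
      change (b * l) x = (b * l) y at this
      rwa [hb] at this
    rw [← hσ ⟨l, hl⟩, smul_add, smul_add, hr, zero_add, smul_comm r, hrq'] at hc
    have h1 : σ c • q' = q' := by
      have := congrArg (r • ·) hc
      simp only [smul_add] at this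
      rw [smul_comm r (σ c) q, hr, smul_zero, zero_add, smul_comm r, hrq',
        smul_comm r (σ c), smul_comm r, hrq', smul_comm (σ c), hσ, hσ ⟨l, hl⟩] at this
      exact (hinj _ _ this).symm
    have h0 : σ c • q = 0 := by
      have := congrArg (s • ·) hc
      simp only [smul_add] at this
      rw [smul_comm s, hs, smul_zero, smul_comm s, hsq, smul_comm s, smul_comm s _ q', hs,
        smul_zero, smul_zero, add_zero] at this
      exact this.symm
    have hc1 : c = ⟨1, hV.one_mem⟩ := eq_of_smul_eq_smul hV hσ hq0' (h1.trans (by rw [hσ]; rfl))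
    rw [hc1, hσ] at h0
    exact hq0 h0
  · intro h
    have h10 : (1 : AddMonoid.End V) ≠ 0 := fun h => hq0 (DFunLike.congr_fun h q)
    refine ⟨1, ⟨hV.one_mem, h10⟩, fun a ha b hb => ?_⟩
    obtain ⟨c, hc, hab⟩ := hq a ha b hb
    refine ⟨c, hc, ?_⟩
    have hm : σ ⟨a, ha⟩ + σ ⟨b, hb⟩ - σ ⟨c, hc⟩ ∈ Ideal.torsionOf R V q := by
      rw [Ideal.mem_torsionOf_iff, sub_smul, add_smul, hσ, hσ, hσ, hab, sub_self]
    rw [h, Ideal.mem_torsionOf_iff, sub_smul, add_smul, hσ, hσ, hσ, sub_eq_zero] at hm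
    change a (q + q') + b (q + q') = c (q + q')
    rw [map_add, map_add, map_add, ← hab, ← hm]
    abel

theorem block_eq (hV : IsFGroup F) (hσ : ∀ a x, σ a • x = (a : AddMonoid.End V) x)
    (hgen : Subring.closure (Set.range σ) = ⊤) {q : V} (hq : q ∈ quasiKernel F) (hq0 : q ≠ 0) :
    block F q = AddSubgroup.closure {y | y ∈ quasiKernel F \ {0} ∧
      Ideal.torsionOf R V q = Ideal.torsionOf R V y} := by
  unfold block
  congr 1
  ext y
  exact and_congr_right fun hy => compatible_iff_torsionOf_eq hV hσ hgen hq hq0 hy.1 hy.2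

theorem smul_eq_zero_of_mem_block (hV : IsFGroup F)
    (hσ : ∀ a x, σ a • x = (a : AddMonoid.End V) x)
    (hgen : Subring.closure (Set.range σ) = ⊤) {q : V} (hq : q ∈ quasiKernel F) (hq0 : q ≠ 0)
    {r : R} (hr : r ∈ Ideal.torsionOf R V q) {x : V} (hx : x ∈ block F q) : r • x = 0 := by
  rw [block_eq hV hσ hgen hq hq0] at hx
  induction hx using AddSubgroup.closure_induction with
  | mem x hx => rwa [hx.2, Ideal.mem_torsionOf_iff] at hr
  | zero => exact smul_zero r
  | add x y _ _ hx hy => rw [smul_add, hx, hy, add_zero]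
  | neg x _ hx => rw [smul_neg, hx, neg_zero]

theorem block_eq_block_iff (hV : IsFGroup F)
    (hσ : ∀ a x, σ a • x = (a : AddMonoid.End V) x)
    (hgen : Subring.closure (Set.range σ) = ⊤) {q q' : V} (hq : q ∈ quasiKernel F) (hq0 : q ≠ 0)
    (hq' : q' ∈ quasiKernel F) (hq0' : q' ≠ 0) :
    block F q = block F q' ↔ Ideal.torsionOf R V q = Ideal.torsionOf R V q' := by
  constructor
  · intro h
    refine (isMaximal_torsionOf hV hσ hgen hq hq0).eq_of_le
      (isMaximal_torsionOf hV hσ hgen hq' hq0').ne_top fun r hr => ?_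
    refine smul_eq_zero_of_mem_block hV hσ hgen hq hq0 hr (x := q') ?_
    rw [h, block_eq hV hσ hgen hq' hq0']
    exact AddSubgroup.subset_closure ⟨⟨hq', hq0'⟩, rfl⟩
  · intro h
    rw [block_eq hV hσ hgen hq hq0, block_eq hV hσ hgen hq' hq0', h]

end Scalars

theorem IsNearVectorSpace.exists_completeOrthogonalIdempotents (hV : IsNearVectorSpace F)
    (hF : IsCommutative F) (n : ℕ) (hn : (blocks F).encard = n)
    (hinf : ∀ W ∈ blocks F, (W : Set V).Infinite) :
    ∃ (R : Type u) (_ : CommRing R) (_ : Module R V) (σ : F → R) (ι : Type u) (_ : Fintype ι)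
      (e : ι → R), (∀ a x, σ a • x = (a : AddMonoid.End V) x) ∧
      σ ⟨-1, hV.neg_one_mem⟩ = -1 ∧
      Subring.closure (Set.range σ) = ⊤ ∧ CompleteOrthogonalIdempotents e ∧
      (∀ i r, e i * r = 0 ∨ ∃ s, s * r * e i = e i) ∧
      (∀ i, (Set.range fun x : V => e i • x).Infinite) ∧ Fintype.card ι = n := by
  classical
  let R := Subring.closure F
  have hcomm := Subring.isMulCommutative_closure (s := F)
    fun a ha b hb => AddMonoidHom.ext (hF a ha b hb)
  let _ : CommRing R :=
    { (inferInstance : Ring R) with mul_comm := hcomm.is_comm.comm }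
  let σ : F → R := fun a => ⟨a, Subring.subset_closure a.2⟩
  have hσ : ∀ a (x : V), σ a • x = (a : AddMonoid.End V) x := fun _ _ => rfl
  have hgen : Subring.closure (Set.range σ) = ⊤ := by
    rw [eq_top_iff]
    rintro ⟨r, hr⟩ -
    induction hr using Subring.closure_induction with
    | mem x hx => exact Subring.subset_closure ⟨⟨x, hx⟩, rfl⟩
    | zero => exact Subring.zero_mem _
    | one => exact Subring.one_mem _
    | add x y _ _ hx hy => exact Subring.add_mem _ hx hy
    | neg x _ hx => exact Subring.neg_mem _ hx
    | mul x y _ _ hx hy => exact Subring.mul_mem _ hx hy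
  have hfin : (blocks F).Finite := Set.finite_of_encard_eq_coe hn
  let _ : Fintype (blocks F) := hfin.fintype
  choose q hq hqW using fun W : blocks F => W.2
  obtain ⟨e, he, hinv, hker⟩ := Ideal.exists_completeOrthogonalIdempotents
    (fun W => Ideal.torsionOf R V (q W))
    (fun W => isMaximal_torsionOf hV.1 hσ hgen (hq W).1 (hq W).2)
    (fun W W' h => Subtype.ext <| by
      rw [hqW, hqW W']
      exact (block_eq_block_iff hV.1 hσ hgen (hq W).1 (hq W).2 (hq W').1 (hq W').2).2 h)
    -- Each nonzero element of the quasi-kernel has the annihilator of its block's representative,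
    -- so `r` kills a generating set of `V`; and `R` acts faithfully.
    (fun r hr => by
      have h0 : ∀ x : V, r • x = 0 := fun x => by
        have hx : x ∈ AddSubgroup.closure (quasiKernel F) :=
          hV.closure_quasiKernel ▸ AddSubgroup.mem_top x
        induction hx using AddSubgroup.closure_induction with
        | mem x hx =>
          by_cases hx0 : x = 0
          · rw [hx0, smul_zero]
          · have h := (block_eq_block_iff hV.1 hσ hgen hx hx0 (hq _).1 (hq _).2).1
              (hqW ⟨block F x, x, ⟨hx, hx0⟩, rfl⟩)
            have := hr ⟨block F x, x, ⟨hx, hx0⟩, rfl⟩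
            rwa [← h, Ideal.mem_torsionOf_iff] at this
        | zero => exact smul_zero r
        | add x y _ _ hx hy => rw [smul_add, hx, hy, add_zero]
        | neg x _ hx => rw [smul_neg, hx, neg_zero]
      exact Subtype.ext (AddMonoidHom.ext h0))
  refine ⟨R, inferInstance, inferInstance, σ, blocks F, inferInstance, e, hσ, rfl, hgen, he, hinv,
    fun W => (hinf W W.2).mono fun x hx => ⟨x, ?_⟩, ?_⟩
  -- `1 - e W` kills the block `W`, so the infinite set `W` lies in the range of `e W`.
  · have := smul_eq_zero_of_mem_block hV.1 hσ hgen (hq W).1 (hq W).2 (hker W) (x := x)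
      (by rw [← hqW]; exact hx)
    rw [sub_smul, one_smul, sub_eq_zero] at this
    exact this.symm
  · rw [← Set.toFinset_card]
    rw [Set.encard_eq_coe_toFinset_card] at hn
    exact_mod_cast hn

end NearVectorSpace

/-! ### Linear equations and small sets in modules over a product of fields -/

namespace NearVectorSpace

open FirstOrder FirstOrder.Language

section Module

variable {R ι M X : Type*} [CommRing R] [Fintype ι] [AddCommGroup M] [Module R M] {e : ι → R}

theorem eq_zero_of_forall_smul_eq_zero (he : CompleteOrthogonalIdempotents e) {x : M}
    (h : ∀ i, e i • x = 0) : x = 0 := by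
  rw [← one_smul R x, ← he.complete, Finset.sum_smul]
  exact Finset.sum_eq_zero fun i _ => h i

theorem exists_forall_smul_eq (he : CompleteOrthogonalIdempotents e) (b : ι → M) :
    ∃ x : M, ∀ i, e i • x = e i • b i := by
  classical
  refine ⟨∑ j, e j • b j, fun i => ?_⟩
  rw [Finset.smul_sum, Finset.sum_eq_single i, smul_smul, (he.idem i).eq]
  · intro j _ hj
    rw [smul_smul, he.ortho hj.symm, zero_smul]
  · simp

/-- The back-and-forth step: the solvability pattern of finitely many linear equations in a new
variable is determined by the solvability pattern of finitely many equations in the old ones. -/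
theorem exists_finite_forall_exists_iff (he : CompleteOrthogonalIdempotents e)
    (hinv : ∀ i r, e i * r = 0 ∨ ∃ s, s * r * e i = e i)
    (hinf : ∀ i, (Set.range fun x : M => e i • x).Infinite)
    (G : Submodule R (X → M)) {K : Type*} [Finite K] (g : K → X → M) (hg : ∀ k, g k ∈ G)
    (r : K → R) :
    ∃ D : Set (X → M), D.Finite ∧ D ⊆ G ∧ ∀ p p', (∀ f ∈ D, f p = 0 ↔ f p' = 0) →
      ∀ a, ∃ a', ∀ k, g k p + r k • a = 0 ↔ g k p' + r k • a' = 0 := by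
  have hs : ∀ k i, ∃ s, e i * r k ≠ 0 → s * r k * e i = e i := fun k i => by
    rcases hinv i (r k) with h | ⟨s, h⟩
    · exact ⟨0, fun h' => absurd h h'⟩
    · exact ⟨s, fun _ => h⟩
  choose s hs using hs
  -- The first forms decide the components in which the new variable does not occur. The second
  -- compare two equations in a component after scaling the new variable's coefficient to 1.
  refine ⟨(Set.range fun c : K × ι => e c.2 • g c.1) ∪
    Set.range fun c : K × K × ι =>
      (e c.2.2 * s c.1 c.2.2) • g c.1 - (e c.2.2 * s c.2.1 c.2.2) • g c.2.1,
    (Set.finite_range _).union (Set.finite_range _), ?_, fun p p' hpp' a => ?_⟩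
  · rintro _ (⟨c, rfl⟩ | ⟨c, rfl⟩)
    · exact G.smul_mem _ (hg _)
    · exact G.sub_mem (G.smul_mem _ (hg _)) (G.smul_mem _ (hg _))
  have h1 : ∀ k i, e i • g k p = 0 ↔ e i • g k p' = 0 := fun k i =>
    hpp' _ (Or.inl ⟨(k, i), rfl⟩)
  have h2 : ∀ k l i, (e i * s k i) • g k p - (e i * s l i) • g l p = 0 ↔
      (e i * s k i) • g k p' - (e i * s l i) • g l p' = 0 := fun k l i =>
    hpp' _ (Or.inr ⟨(k, l, i), rfl⟩)
  -- In each component separately: if some equation holds at `a`, solve it over `p'`; the others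
  -- follow by comparison with it. If none holds, avoid the finitely many solutions over `p'`, which
  -- is possible because the component is infinite.
  have hb : ∀ i, ∃ b : M, ∀ k, e i * r k ≠ 0 →
      ((e i * s k i) • g k p + e i • a = 0 ↔ (e i * s k i) • g k p' + e i • b = 0) := fun i => by
    by_cases hk : ∃ k, e i * r k ≠ 0 ∧ (e i * s k i) • g k p + e i • a = 0
    · obtain ⟨k, -, hk⟩ := hk
      refine ⟨-(s k i • g k p'), fun l _ => ?_⟩
      rw [eq_neg_of_add_eq_zero_right hk, ← sub_eq_add_neg, smul_neg, smul_smul,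
        ← sub_eq_add_neg]
      exact h2 l k i
    · push Not at hk
      obtain ⟨_, ⟨b, rfl⟩, hb⟩ := (hinf i).exists_notMem_finite
        (Set.finite_range fun k => -((e i * s k i) • g k p'))
      refine ⟨b, fun k hrk => iff_of_false (hk k hrk) fun h => hb ⟨k, ?_⟩⟩
      exact (eq_neg_of_add_eq_zero_right h).symm
  choose b hb using hb
  obtain ⟨a', ha'⟩ := exists_forall_smul_eq he b
  have key : ∀ k i (y z : M), e i * r k ≠ 0 →
      (e i • (y + r k • z) = 0 ↔ (e i * s k i) • y + e i • z = 0) := fun k i y z hrk => by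
    constructor
    · intro h
      have h' := congrArg (s k i • ·) h
      simp only [smul_zero, smul_add, smul_smul] at h'
      rw [← h', mul_comm (e i), show s k i * (e i * r k) = s k i * r k * e i by ring, hs k i hrk]
    · intro h
      have h' := congrArg (r k • ·) h
      simp only [smul_zero, smul_add, smul_smul] at h'
      rw [← h', smul_add, smul_smul, mul_comm (e i) (r k),
        show r k * (e i * s k i) = s k i * r k * e i by ring, hs k i hrk]
  have key' : ∀ k i, e i • (g k p + r k • a) = 0 ↔ e i • (g k p' + r k • a') = 0 := fun k i => by
    by_cases hrk : e i * r k = 0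
    · rw [smul_add, smul_add, smul_smul, smul_smul, hrk, zero_smul, zero_smul, add_zero, add_zero]
      exact h1 k i
    · rw [key k i _ _ hrk, key k i _ _ hrk, ha']
      exact hb i k hrk
  refine ⟨a', fun k => ⟨fun h => ?_, fun h => ?_⟩⟩
  · exact eq_zero_of_forall_smul_eq_zero he fun i => (key' k i).1 (by rw [h, smul_zero])
  · exact eq_zero_of_forall_smul_eq_zero he fun i => (key' k i).2 (by rw [h, smul_zero])

/-- The coset of `a` modulo the sum of the components `e i • M` with `i ∈ S`. -/
def coset (e : ι → R) (S : Finset ι) (a : M) : Set M :=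
  {x | ∀ i ∉ S, e i • x = e i • a}

/-- A set is `k`-small if it is covered by finitely many cosets of sums of fewer than `k`
components. -/
def IsSmall (e : ι → R) (k : ℕ) (D : Set M) : Prop :=
  ∃ P : Set (Finset ι × M), P.Finite ∧ (∀ c ∈ P, c.1.card < k) ∧ D ⊆ ⋃ c ∈ P, coset e c.1 c.2

omit [Fintype ι] in
theorem IsSmall.mono {k : ℕ} {D D' : Set M} (h : IsSmall e k D) (hD : D' ⊆ D) :
    IsSmall e k D' := by
  obtain ⟨P, hP, hPk, hDP⟩ := h
  exact ⟨P, hP, hPk, hD.trans hDP⟩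

omit [Fintype ι] in
theorem isSmall_biUnion {k : ℕ} {J : Type*} {A : Set J} (hA : A.Finite) {D : J → Set M}
    (h : ∀ j ∈ A, IsSmall e k (D j)) : IsSmall e k (⋃ j ∈ A, D j) := by
  choose! P hP hPk hDP using h
  refine ⟨⋃ j ∈ A, P j, hA.biUnion hP, ?_, ?_⟩
  · intro c hc
    obtain ⟨j, hj, hc⟩ := Set.mem_iUnion₂.1 hc
    exact hPk j hj c hc
  · intro x hx
    obtain ⟨j, hj, hx⟩ := Set.mem_iUnion₂.1 hx
    obtain ⟨c, hc, hx⟩ := Set.mem_iUnion₂.1 (hDP j hj hx)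
    exact Set.mem_iUnion₂.2 ⟨c, Set.mem_iUnion₂.2 ⟨j, hj, hc⟩, hx⟩

omit [Fintype ι] in
theorem isSmall_coset {k : ℕ} {S : Finset ι} (hS : S.card < k) (a : M) :
    IsSmall e k (coset e S a) :=
  ⟨{(S, a)}, Set.finite_singleton _, by simpa using hS, by simp⟩

/-- If `x` is a solution and `y` is not, then `r • (x - y)` has a nonzero component `i`, necessarily
in `S`. As `r` is invertible there, all solutions share the `i`-component of `x` and lie in one
coset for `S.erase i`. -/
theorem coset_subset_or_isSmall (he : CompleteOrthogonalIdempotents e)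
    (hinv : ∀ i r, e i * r = 0 ∨ ∃ s, s * r * e i = e i) (S : Finset ι) (a m : M) (r : R) :
    coset e S a ⊆ {x | m + r • x = 0} ∨ IsSmall e S.card (coset e S a ∩ {x | m + r • x = 0}) := by
  classical
  by_contra! h
  obtain ⟨h, hsmall⟩ := h
  obtain ⟨y, hy, hy0⟩ := Set.not_subset.1 h
  have hne : (coset e S a ∩ {x | m + r • x = 0}).Nonempty := by
    by_contra hne
    exact hsmall ⟨∅, Set.finite_empty, by simp,
      by rw [Set.not_nonempty_iff_eq_empty.1 hne]; exact Set.empty_subset _⟩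
  obtain ⟨x, hx, hx0⟩ := hne
  have hxy : ∃ i, e i • r • (x - y) ≠ 0 := by
    by_contra! hxy
    have h0 := eq_zero_of_forall_smul_eq_zero he hxy
    rw [smul_sub, sub_eq_zero] at h0
    exact hy0 ((congrArg (m + ·) h0).symm.trans hx0)
  obtain ⟨i, hi⟩ := hxy
  have hiS : i ∈ S := by
    by_contra hiS
    apply hi
    rw [smul_comm, smul_sub, hx i hiS, hy i hiS, sub_self, smul_zero]
  obtain ⟨s, hs⟩ := (hinv i r).resolve_left fun h0 => hi (by rw [smul_smul, h0, zero_smul])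
  refine hsmall ((isSmall_coset (S := S.erase i) (Finset.card_erase_lt_of_mem hiS) x).mono ?_)
  rintro z ⟨hz, hz0⟩ j hj
  by_cases hji : j = i
  · have hrz : r • z = r • x := add_left_cancel (a := m) (hz0.trans hx0.symm)
    rw [hji, ← hs, mul_right_comm, mul_smul, hrz, smul_smul]
  · have hjS : j ∉ S := fun h => hj (Finset.mem_erase.2 ⟨hji, h⟩)
    rw [hz j hjS, hx j hjS]

/-- Membership in `D` is determined by finitely many affine equations. -/
def IsEquational (R : Type*) [CommRing R] [Module R M] (D : Set M) : Prop :=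
  ∃ E : Set (M × R), E.Finite ∧
    ∀ x x', (∀ c ∈ E, c.1 + c.2 • x = 0 ↔ c.1 + c.2 • x' = 0) → x ∈ D → x' ∈ D

/-- Remove from the coset the small set `B` where some equation holds that does not hold on the
whole coset. All remaining points satisfy the same equations, so they lie all in `D` or all outside
it. -/
theorem IsEquational.isSmall_inter_or_isSmall_diff (he : CompleteOrthogonalIdempotents e)
    (hinv : ∀ i r, e i * r = 0 ∨ ∃ s, s * r * e i = e i) {D : Set M} (hD : IsEquational R D)
    (S : Finset ι) (a : M) :
    IsSmall e S.card (coset e S a ∩ D) ∨ IsSmall e S.card (coset e S a \ D) := by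
  obtain ⟨E, hE, hED⟩ := hD
  let Z : M × R → Set M := fun c => {x | c.1 + c.2 • x = 0}
  have hB : IsSmall e S.card
      (⋃ c ∈ {c ∈ E | ¬ coset e S a ⊆ Z c}, (coset e S a ∩ Z c)) :=
    isSmall_biUnion (hE.subset (Set.sep_subset _ _)) fun c hc =>
      (coset_subset_or_isSmall he hinv S a c.1 c.2).resolve_left hc.2
  set B := ⋃ c ∈ {c ∈ E | ¬ coset e S a ⊆ Z c}, (coset e S a ∩ Z c) with hBdef
  have hiff : ∀ x ∈ coset e S a \ B, ∀ c ∈ E, c.1 + c.2 • x = 0 ↔ coset e S a ⊆ Z c :=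
    fun x hx c hc => by
      refine ⟨fun h0 => ?_, fun h => h hx.1⟩
      by_contra h
      exact hx.2 (Set.mem_iUnion₂.2 ⟨c, ⟨hc, h⟩, hx.1, h0⟩)
  by_cases h : ∃ x ∈ coset e S a \ B, x ∈ D
  · obtain ⟨x, hx, hxD⟩ := h
    refine Or.inr (hB.mono fun y hy => ?_)
    by_contra hyB
    exact hy.2 (hED x y
      (fun c hc => (hiff x hx c hc).trans (hiff y ⟨hy.1, hyB⟩ c hc).symm) hxD)
  · push Not at h
    refine Or.inl (hB.mono fun y hy => ?_)
    by_contra hyB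
    exact h y ⟨hy.1, hyB⟩ hy.2

end Module

/-! ### Definable sets are given by finitely many equations -/

section Definable

variable {V : Type u} [AddCommGroup V] {F : Set (AddMonoid.End V)}
variable {R ι : Type*} [CommRing R] [Fintype ι] {e : ι → R}

/-- `M` is a module over `R`, where the language of near vector spaces is interpreted through
`σ : F → R`. -/
structure IsModuleStructure (σ : F → R) (M : Type*) [AddCommGroup M] [Module R M]
    [(lang F).Structure M] : Prop where
  funMap_zero : ∀ v : Fin 0 → M, Structure.funMap (L := lang F) (Func.zero (F := F)) v = 0
  funMap_add : ∀ v : Fin 2 → M, Structure.funMap (L := lang F) (Func.add (F := F)) v = v 0 + v 1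
  funMap_scalar : ∀ a, ∀ v : Fin 1 → M,
    Structure.funMap (L := lang F) (Func.scalar (F := F) a) v = σ a • v 0

variable {M : Type*} [AddCommGroup M] [Module R M] {α : Type*}

/-- The linear forms in the variables `α` and `Fin n`. -/
def linearForms (R M α : Type*) [CommRing R] [AddCommGroup M] [Module R M] (n : ℕ) :
    Submodule R ((α → M) × (Fin n → M) → M) :=
  Submodule.span R ((Set.range fun i p => p.1 i) ∪ Set.range fun j p => p.2 j)

theorem exists_linearForms_snoc {n : ℕ} {g : (α → M) × (Fin (n + 1) → M) → M}
    (hg : g ∈ linearForms R M α (n + 1)) :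
    ∃ f ∈ linearForms R M α n, ∃ r : R, ∀ p a, g (p.1, Fin.snoc p.2 a) = f p + r • a := by
  induction hg using Submodule.span_induction with
  | mem g hg =>
    rcases hg with ⟨i, rfl⟩ | ⟨j, rfl⟩
    · exact ⟨fun p => p.1 i, Submodule.subset_span (Or.inl ⟨i, rfl⟩), 0, fun p a => by simp⟩
    · induction j using Fin.lastCases with
      | last => exact ⟨0, Submodule.zero_mem _, 1, fun p a => by simp⟩
      | cast j =>
        exact ⟨fun p => p.2 j, Submodule.subset_span (Or.inr ⟨j, rfl⟩), 0, fun p a => by simp⟩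
  | zero => exact ⟨0, Submodule.zero_mem _, 0, fun p a => by simp⟩
  | add g g' _ _ hg hg' =>
    obtain ⟨f, hf, r, h⟩ := hg
    obtain ⟨f', hf', r', h'⟩ := hg'
    refine ⟨f + f', Submodule.add_mem _ hf hf', r + r', fun p a => ?_⟩
    rw [Pi.add_apply, h, h', Pi.add_apply, add_smul]
    abel
  | smul c g _ hg =>
    obtain ⟨f, hf, r, h⟩ := hg
    refine ⟨c • f, Submodule.smul_mem _ _ hf, c * r, fun p a => ?_⟩
    rw [Pi.smul_apply, h, Pi.smul_apply, smul_add, smul_smul]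

theorem exists_linearForms_eq_affine {g : (M ⊕ Fin 1 → M) × (Fin 0 → M) → M}
    (hg : g ∈ linearForms R M (M ⊕ Fin 1) 0) :
    ∃ (m : M) (r : R), ∀ x, g (Sum.elim id fun _ => x, default) = m + r • x := by
  induction hg using Submodule.span_induction with
  | mem g hg =>
    rcases hg with ⟨m | j, rfl⟩ | ⟨j, rfl⟩
    · exact ⟨m, 0, fun x => by simp⟩
    · exact ⟨0, 1, fun x => by simp⟩
    · exact j.elim0
  | zero => exact ⟨0, 0, fun x => by simp⟩
  | add g g' _ _ hg hg' =>
    obtain ⟨m, r, h⟩ := hg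
    obtain ⟨m', r', h'⟩ := hg'
    refine ⟨m + m', r + r', fun x => ?_⟩
    rw [Pi.add_apply, h, h', add_smul]
    abel
  | smul c g _ hg =>
    obtain ⟨m, r, h⟩ := hg
    refine ⟨c • m, c * r, fun x => ?_⟩
    rw [Pi.smul_apply, h, smul_add, smul_smul]

variable [(lang F).Structure M] {σ : F → R}

theorem IsModuleStructure.realize_term_mem_linearForms (hM : IsModuleStructure σ M) {n : ℕ}
    (t : (lang F).Term (α ⊕ Fin n)) :
    (fun p => t.realize (Sum.elim p.1 p.2)) ∈ linearForms R M α n := by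
  induction t with
  | var i =>
    rcases i with i | j
    · exact Submodule.subset_span (Or.inl ⟨i, rfl⟩)
    · exact Submodule.subset_span (Or.inr ⟨j, rfl⟩)
  | func f ts ih =>
    cases f with
    | zero =>
      exact (congrArg (· ∈ linearForms R M α n) (funext fun p => hM.funMap_zero _)).mpr
        (Submodule.zero_mem _)
    | add =>
      exact (congrArg (· ∈ linearForms R M α n) (funext fun p => hM.funMap_add _)).mpr
        (Submodule.add_mem _ (ih 0) (ih 1))
    | scalar a =>
      exact (congrArg (· ∈ linearForms R M α n) (funext fun p => hM.funMap_scalar _ _)).mpr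
        (Submodule.smul_mem _ _ (ih 0))

/-- This replaces quantifier elimination: the truth of a formula depends only on which of finitely
many linear forms vanish. The quantifier step is `exists_finite_forall_exists_iff`. -/
theorem IsModuleStructure.exists_finite_linearForms (hM : IsModuleStructure σ M)
    (he : CompleteOrthogonalIdempotents e)
    (hinv : ∀ i r, e i * r = 0 ∨ ∃ s, s * r * e i = e i)
    (hinf : ∀ i, (Set.range fun x : M => e i • x).Infinite) {n : ℕ}
    (φ : (lang F).BoundedFormula α n) :
    ∃ D : Set ((α → M) × (Fin n → M) → M), D.Finite ∧ D ⊆ linearForms R M α n ∧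
      ∀ p p', (∀ f ∈ D, f p = 0 ↔ f p' = 0) → φ.Realize p.1 p.2 → φ.Realize p'.1 p'.2 := by
  induction φ with
  | falsum => exact ⟨∅, Set.finite_empty, Set.empty_subset _, fun _ _ _ h => h⟩
  | equal t₁ t₂ =>
    refine ⟨{(fun p => t₁.realize (Sum.elim p.1 p.2)) - fun p => t₂.realize (Sum.elim p.1 p.2)},
      Set.finite_singleton _, ?_, fun p p' h h' => ?_⟩
    · rw [Set.singleton_subset_iff]
      exact Submodule.sub_mem _ (hM.realize_term_mem_linearForms t₁)
        (hM.realize_term_mem_linearForms t₂)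
    · exact sub_eq_zero.1 ((h _ rfl).1 (sub_eq_zero.2 h'))
  | rel r _ => exact r.elim
  | imp φ ψ hφ hψ =>
    obtain ⟨D, hD, hDl, h⟩ := hφ
    obtain ⟨D', hD', hDl', h'⟩ := hψ
    refine ⟨D ∪ D', hD.union hD', Set.union_subset hDl hDl', fun p p' hpp' hp hp' => ?_⟩
    exact h' p p' (fun f hf => hpp' f (Or.inr hf))
      (hp (h p' p (fun f hf => (hpp' f (Or.inl hf)).symm) hp'))
  | all φ hφ =>
    obtain ⟨D, hD, hDl, h⟩ := hφ
    choose f hf r hfr using fun g : D => exists_linearForms_snoc (hDl g.2)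
    have := hD.to_subtype
    obtain ⟨D', hD', hDl', h'⟩ :=
      exists_finite_forall_exists_iff he hinv hinf (linearForms R M _ _) f hf r
    refine ⟨D', hD', hDl', fun p p' hpp' hp a' => ?_⟩
    obtain ⟨a, ha⟩ := h' p' p (fun g hg => (hpp' g hg).symm) a'
    refine h (p.1, Fin.snoc p.2 a) (p'.1, Fin.snoc p'.2 a') (fun g hg => ?_) (hp a)
    have hfr' := hfr ⟨g, hg⟩
    simp only at hfr'
    rw [hfr', hfr']
    exact (ha ⟨g, hg⟩).symm

theorem IsModuleStructure.isEquational (hM : IsModuleStructure σ M)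
    (he : CompleteOrthogonalIdempotents e)
    (hinv : ∀ i r, e i * r = 0 ∨ ∃ s, s * r * e i = e i)
    (hinf : ∀ i, (Set.range fun x : M => e i • x).Infinite)
    (φ : (lang F).Formula (M ⊕ Fin 1)) :
    IsEquational R {x : M | φ.Realize (Sum.elim id fun _ => x)} := by
  obtain ⟨D, hD, hDl, h⟩ := hM.exists_finite_linearForms he hinv hinf φ
  choose m r hmr using fun g : D => exists_linearForms_eq_affine (hDl g.2)
  have := hD.to_subtype
  refine ⟨Set.range fun g => (m g, r g), Set.finite_range _, fun x x' hxx' hx => ?_⟩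
  refine h (Sum.elim id fun _ => x, default) (Sum.elim id fun _ => x', default)
    (fun g hg => ?_) hx
  have hmr' := hmr ⟨g, hg⟩
  simp only at hmr'
  rw [hmr', hmr']
  exact hxx' _ ⟨⟨g, hg⟩, rfl⟩

end Definable

end NearVectorSpace

/-! ### Terms for scalars and transfer to other models -/

namespace NearVectorSpace

open FirstOrder FirstOrder.Language MorleyRank

variable {V : Type u} [AddCommGroup V] {F : Set (AddMonoid.End V)}
variable {R ι : Type*} [CommRing R] [Fintype ι]

section Terms

variable {α : Type*}

/-- The term `0`. -/
def zeroTerm (F : Set (AddMonoid.End V)) (α : Type*) : (lang F).Term α :=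
  Term.func (L := lang F) (Func.zero (F := F)) Fin.elim0

/-- The term `s + t`. -/
def addTerm (s t : (lang F).Term α) : (lang F).Term α :=
  Term.func (L := lang F) (Func.add (F := F)) ![s, t]

/-- The term `a t`. -/
def scalarTerm (a : F) (t : (lang F).Term α) : (lang F).Term α :=
  Term.func (L := lang F) (Func.scalar a) ![t]

/-- The term `t(s)`. -/
def compTerm (t : (lang F).Term (Fin 1)) (s : (lang F).Term α) : (lang F).Term α :=
  t.subst fun _ => s

variable {M : Type*} [AddCommGroup M] [Module R M] [(lang F).Structure M] {σ : F → R}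

theorem IsModuleStructure.realize_zeroTerm (hM : IsModuleStructure σ M) (v : α → M) :
    (zeroTerm F α).realize v = 0 :=
  hM.funMap_zero _

theorem IsModuleStructure.realize_addTerm (hM : IsModuleStructure σ M)
    (s t : (lang F).Term α) (v : α → M) :
    (addTerm s t).realize v = s.realize v + t.realize v :=
  hM.funMap_add _

theorem IsModuleStructure.realize_scalarTerm (hM : IsModuleStructure σ M) (a : F)
    (t : (lang F).Term α) (v : α → M) :
    (scalarTerm a t).realize v = σ a • t.realize v :=
  hM.funMap_scalar a _

omit [AddCommGroup M] in
theorem realize_compTerm (t : (lang F).Term (Fin 1)) (s : (lang F).Term α) (v : α → M) :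
    (compTerm t s).realize v = t.realize fun _ => s.realize v :=
  Term.realize_subst

/-- Every scalar is given by a term. -/
theorem IsModuleStructure.exists_term (hM : IsModuleStructure σ M) (hF : (-1) ∈ F)
    (hσ : σ ⟨-1, hF⟩ = -1) (hgen : Subring.closure (Set.range σ) = ⊤) (r : R) :
    ∃ t : (lang F).Term (Fin 1), ∀ x : M, t.realize (fun _ => x) = r • x := by
  have hr : r ∈ Subring.closure (Set.range σ) := hgen ▸ Subring.mem_top r
  induction hr using Subring.closure_induction with
  | mem r hr =>
    obtain ⟨a, rfl⟩ := hr
    exact ⟨scalarTerm a (Term.var 0), fun x => hM.realize_scalarTerm _ _ _⟩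
  | zero => exact ⟨zeroTerm F _, fun x => by rw [hM.realize_zeroTerm, zero_smul]⟩
  | one => exact ⟨Term.var 0, fun x => (one_smul R x).symm⟩
  | add r r' _ _ hr hr' =>
    obtain ⟨t, ht⟩ := hr
    obtain ⟨t', ht'⟩ := hr'
    exact ⟨addTerm t t', fun x => by rw [hM.realize_addTerm, ht, ht', add_smul]⟩
  | neg r _ hr =>
    obtain ⟨t, ht⟩ := hr
    exact ⟨scalarTerm ⟨-1, hF⟩ t, fun x => by
      rw [hM.realize_scalarTerm, ht, hσ, neg_smul, one_smul, neg_smul]⟩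
  | mul r r' _ _ hr hr' =>
    obtain ⟨t, ht⟩ := hr
    obtain ⟨t', ht'⟩ := hr'
    exact ⟨compTerm t t', fun x => by rw [realize_compTerm, ht', ht, mul_smul]⟩

end Terms

section Transfer

variable {L : FirstOrder.Language.{u, u}} {V M : Type u} [L.Structure V] [L.Structure M]

theorem realize_eq_of_model (hM : M ⊨ L.completeTheory V) {α : Type} [Finite α] (s t : L.Term α)
    (h : ∀ v : α → V, s.realize v = t.realize v) (v : α → M) : s.realize v = t.realize v := by
  let φ : L.Sentence :=
    ((s.relabel Sum.inr).equal (t.relabel Sum.inr) : L.Formula (Empty ⊕ α)).iAlls α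
  have hφ : ∀ {N : Type u} [L.Structure N], N ⊨ φ ↔ ∀ v : α → N, s.realize v = t.realize v :=
    fun {N} _ => by
      simp only [φ, Sentence.Realize, Formula.realize_iAlls, Formula.realize_equal,
        Term.realize_relabel]
      rfl
  exact hφ.1 ((realize_iff_of_model_completeTheory V M φ).2 (hφ.2 h)) v

theorem infinite_range_realize_of_model (hM : M ⊨ L.completeTheory V) (t : L.Term (Fin 1))
    (h : (Set.range fun x : V => t.realize fun _ => x).Infinite) :
    (Set.range fun x : M => t.realize fun _ => x).Infinite := by
  intro hfin
  -- One more than the supposed size of the range in `M`; the sentence `φ` asserts `k` distinct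
  -- values and holds in `V`.
  let k := hfin.toFinset.card + 1
  let φ : L.Sentence := (Formula.iInf fun c : {c : Fin k × Fin k // c.1 ≠ c.2} =>
    ((t.relabel fun _ => Sum.inr c.1.1).equal (t.relabel fun _ => Sum.inr c.1.2)).not :
    L.Formula (Empty ⊕ Fin k)).iExs (Fin k)
  have hφ : ∀ {N : Type u} [L.Structure N], N ⊨ φ ↔
      ∃ v : Fin k → N, Function.Injective fun j => t.realize fun _ => v j := fun {N} _ => by
    simp only [φ, Sentence.Realize, Formula.realize_iExs, Formula.realize_iInf,
      Formula.realize_not, Formula.realize_equal, Term.realize_relabel]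
    refine exists_congr fun v => ⟨fun h i j hij => ?_, fun h c hc => c.2 (h hc)⟩
    by_contra hne
    exact h ⟨(i, j), hne⟩ hij
  have hV : V ⊨ φ := by
    rw [hφ]
    choose v hv using fun j : Fin k => (h.natEmbedding _ j).2
    refine ⟨v, fun i j hij => Fin.ext ((h.natEmbedding _).injective (Subtype.ext ?_))⟩
    rw [← hv, ← hv]
    exact hij
  obtain ⟨v, hv⟩ := hφ.1 ((realize_iff_of_model_completeTheory V M φ).2 hV)
  have := Finset.card_le_card_of_injOn (s := (Finset.univ : Finset (Fin k))) (t := hfin.toFinset)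
    _ (fun j _ => by simp) hv.injOn
  simp [k] at this

end Transfer

/-- `M` is a module over `R` in which the language of near vector spaces is interpreted through
`σ`, the scalar `r` is given by the term `t r`, and all the components `e i • M` are infinite. -/
structure IsModuleModel (σ : F → R) (t : R → (lang F).Term (Fin 1)) (e : ι → R) (M : Type*)
    [AddCommGroup M] [Module R M] [(lang F).Structure M] : Prop extends
    IsModuleStructure σ M where
  realize : ∀ r (x : M), (t r).realize (fun _ => x) = r • x
  infinite : ∀ i, (Set.range fun x : M => e i • x).Infinite

variable {σ : F → R} {t : R → (lang F).Term (Fin 1)} {e : ι → R}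

omit [Fintype ι] in
-- Operations and scalars are given by terms, and the module axioms are identities between terms in
-- at most three variables, so they pass from `V` to `M`.
theorem IsModuleModel.exists_isModuleModel [Module R V] (hV : IsModuleModel σ t e V) {M : Type u}
    [(lang F).Structure M] (hM : M ⊨ (lang F).completeTheory V) :
    ∃ (_ : AddCommGroup M) (_ : Module R M), IsModuleModel σ t e M := by
  have key : ∀ (s s' : (lang F).Term (Fin 3)), (∀ v : Fin 3 → V, s.realize v = s'.realize v) →
      ∀ v : Fin 3 → M, s.realize v = s'.realize v := fun s s' => realize_eq_of_model hM s s'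
  let X : Fin 3 → (lang F).Term (Fin 3) := Term.var
  let _ : Zero M := ⟨Structure.funMap (L := lang F) (Func.zero (F := F)) Fin.elim0⟩
  let _ : Add M := ⟨fun x y => Structure.funMap (L := lang F) (Func.add (F := F)) ![x, y]⟩
  let _ : SMul R M := ⟨fun r x => (t r).realize fun _ => x⟩
  let _ : Neg M := ⟨fun x => (-1 : R) • x⟩
  have hzero : ∀ v : Fin 3 → M, (zeroTerm F (Fin 3)).realize v = 0 := fun v =>
    congrArg (Structure.funMap (L := lang F) (Func.zero (F := F))) (Subsingleton.elim _ _)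
  have hadd : ∀ (s s' : (lang F).Term (Fin 3)) (v : Fin 3 → M),
      (addTerm s s').realize v = s.realize v + s'.realize v := fun s s' v =>
    congrArg (Structure.funMap (L := lang F) (Func.add (F := F)))
      (funext (Fin.forall_fin_two.2 ⟨rfl, rfl⟩))
  have hsmul : ∀ (r : R) (s : (lang F).Term (Fin 3)) (v : Fin 3 → M),
      (compTerm (t r) s).realize v = r • s.realize v := fun r s v => realize_compTerm _ _ _
  have hX : ∀ i (v : Fin 3 → M), (X i).realize v = v i := fun _ _ => rfl
  have hsmulV : ∀ (r : R) (s : (lang F).Term (Fin 3)) (v : Fin 3 → V),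
      (compTerm (t r) s).realize v = r • s.realize v := fun r s v => by
    rw [realize_compTerm, hV.realize]
  let _ : AddCommGroup M :=
    { add_assoc := fun x y z => by
        simpa only [hadd, hX, Matrix.cons_val] using key (addTerm (addTerm (X 0) (X 1)) (X 2))
          (addTerm (X 0) (addTerm (X 1) (X 2)))
          (fun v => by simp only [hV.realize_addTerm, add_assoc]) ![x, y, z]
      zero_add := fun x => by
        simpa only [hadd, hX, hzero, Matrix.cons_val] using key (addTerm (zeroTerm F _) (X 0)) (X 0)
          (fun v => by simp only [hV.realize_addTerm, hV.realize_zeroTerm, zero_add]) ![x, x, x]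
      add_zero := fun x => by
        simpa only [hadd, hX, hzero, Matrix.cons_val] using key (addTerm (X 0) (zeroTerm F _)) (X 0)
          (fun v => by simp only [hV.realize_addTerm, hV.realize_zeroTerm, add_zero]) ![x, x, x]
      add_comm := fun x y => by
        simpa only [hadd, hX, Matrix.cons_val] using key (addTerm (X 0) (X 1)) (addTerm (X 1) (X 0))
          (fun v => by simp only [hV.realize_addTerm, add_comm]) ![x, y, x]
      neg_add_cancel := fun x => by
        have := key (addTerm (compTerm (t (-1)) (X 0)) (X 0)) (zeroTerm F _)
          (fun v => by simp only [hV.realize_addTerm, hV.realize_zeroTerm, hsmulV, neg_smul,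
            one_smul, neg_add_cancel]) ![x, x, x]
        simp only [hadd, hX, hzero, hsmul] at this
        exact this
      nsmul := nsmulRec
      zsmul := zsmulRec }
  let _ : Module R M :=
    { one_smul := fun x => by
        simpa only [hsmul, hX, Matrix.cons_val] using key (compTerm (t 1) (X 0)) (X 0)
          (fun v => by simp only [hsmulV, one_smul]) ![x, x, x]
      mul_smul := fun r s x => by
        simpa only [hsmul, hX, Matrix.cons_val] using key (compTerm (t (r * s)) (X 0))
          (compTerm (t r) (compTerm (t s) (X 0)))
          (fun v => by simp only [hsmulV, mul_smul]) ![x, x, x]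
      smul_zero := fun r => by
        simpa only [hsmul, hX, hzero, Matrix.cons_val] using key (compTerm (t r) (zeroTerm F _)) (zeroTerm F _)
          (fun v => by simp only [hsmulV, hV.realize_zeroTerm, smul_zero]) ![0, 0, 0]
      smul_add := fun r x y => by
        simpa only [hsmul, hX, hadd, Matrix.cons_val] using key (compTerm (t r) (addTerm (X 0) (X 1)))
          (addTerm (compTerm (t r) (X 0)) (compTerm (t r) (X 1)))
          (fun v => by simp only [hsmulV, hV.realize_addTerm, smul_add]) ![x, y, x]
      add_smul := fun r s x => by
        simpa only [hsmul, hX, hadd, Matrix.cons_val] using key (compTerm (t (r + s)) (X 0))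
          (addTerm (compTerm (t r) (X 0)) (compTerm (t s) (X 0)))
          (fun v => by simp only [hsmulV, hV.realize_addTerm, add_smul]) ![x, x, x]
      zero_smul := fun x => by
        simpa only [hsmul, hX, hzero, Matrix.cons_val] using key (compTerm (t 0) (X 0)) (zeroTerm F _)
          (fun v => by simp only [hsmulV, hV.realize_zeroTerm, zero_smul]) ![x, x, x] }
  refine ⟨inferInstance, inferInstance, ⟨fun v => ?_, fun v => ?_, fun a v => ?_⟩,
    fun _ _ => rfl, fun i => ?_⟩
  · exact congrArg (Structure.funMap (L := lang F) (Func.zero (F := F))) (Subsingleton.elim _ _)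
  · exact congrArg (Structure.funMap (L := lang F) (Func.add (F := F)))
      (funext (Fin.forall_fin_two.2 ⟨rfl, rfl⟩))
  · have h := key (scalarTerm a (X 0)) (compTerm (t (σ a)) (X 0))
      (fun w => by rw [hsmulV, hV.realize_scalarTerm]) fun _ => v 0
    rw [hsmul] at h
    refine Eq.trans ?_ h
    exact congrArg (Structure.funMap (L := lang F) (Func.scalar (F := F) a))
      (funext (Fin.forall_fin_one.2 rfl))
  · exact infinite_range_realize_of_model hM (t (e i)) (by simpa only [hV.realize] using hV.infinite i)

/-! ### Upper and lower bounds for the Morley rank -/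

section Rank

variable {M : Type u} [AddCommGroup M] [Module R M] [(lang F).Structure M]

/-- The formula that defines the coset of `a` modulo the sum of the components in `S`. -/
noncomputable def cosetFormula (t : R → (lang F).Term (Fin 1)) (e : ι → R) (S : Finset ι) (a : M) :
    (lang F).Formula (M ⊕ Fin 1) :=
  Formula.iInf fun i : {i // i ∉ S} =>
    ((t (e i)).relabel fun _ => Sum.inr 0).equal ((t (e i)).relabel fun _ => Sum.inl a)

omit [AddCommGroup M] [Module R M] [(lang F).Structure M] in
theorem IsModuleModel.realize_cosetFormula {N : Type u} [AddCommGroup N] [Module R N]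
    [(lang F).Structure N] (hN : IsModuleModel σ t e N) (S : Finset ι) (a : M) (f : M → N)
    (v : Fin 1 → N) :
    (cosetFormula t e S a).Realize (Sum.elim f v) ↔ v 0 ∈ coset e S (f a) := by
  simp only [cosetFormula, Formula.realize_iInf, Formula.realize_equal, Term.realize_relabel,
    Subtype.forall]
  refine forall₂_congr fun i _ => ?_
  rw [← hN.realize, ← hN.realize]
  rfl

/-- The subset of `N` defined by a formula in one variable with parameters in `M`. -/
def definedSet {N : Type u} [(lang F).Structure N] (f : M → N)
    (φ : (lang F).Formula (M ⊕ Fin 1)) : Set N :=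
  {x | Holds f φ fun _ => x}

omit [AddCommGroup M] [Module R M] [(lang F).Structure M] in
theorem mem_definedSet {N : Type u} [(lang F).Structure N] {f : M → N}
    {φ : (lang F).Formula (M ⊕ Fin 1)} {v : Fin 1 → N} : v 0 ∈ definedSet f φ ↔ Holds f φ v := by
  have : (fun _ => v 0) = v := funext (Fin.forall_fin_one.2 rfl)
  rw [definedSet, Set.mem_ofPred_eq, this]

/-- A given finite cover by cosets is a first-order statement about the parameters. -/
theorem IsModuleModel.isSmall_of_elementaryEmbedding (hM : IsModuleModel σ t e M) {N : Type u}
    [AddCommGroup N] [Module R N] [(lang F).Structure N] (hN : IsModuleModel σ t e N)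
    (f : M ↪ₑ[lang F] N) {k : ℕ} {φ : (lang F).Formula (M ⊕ Fin 1)}
    (h : IsSmall e k (definedSet id φ)) : IsSmall e k (definedSet f φ) := by
  obtain ⟨P, hP, hPk, hφP⟩ := h
  have := hP.to_subtype
  let χ : (lang F).Formula (M ⊕ Fin 1) :=
    Formula.iSup fun c : P => cosetFormula t e c.1.1 c.1.2
  have h1 : ((φ.imp χ).iAlls (Fin 1)).Realize (id : M → M) := by
    rw [Formula.realize_iAlls]
    intro v
    rw [Formula.realize_imp]
    intro hv
    obtain ⟨c, hc, hcv⟩ := Set.mem_iUnion₂.1 (hφP (mem_definedSet.2 hv))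
    exact Formula.realize_iSup.2 ⟨⟨c, hc⟩, (hM.realize_cosetFormula _ _ _ _).2 hcv⟩
  have h2 : ((φ.imp χ).iAlls (Fin 1)).Realize (f ∘ id) := (f.map_formula _ _).2 h1
  rw [Formula.realize_iAlls] at h2
  refine ⟨(fun c => (c.1, f c.2)) '' P, hP.image _, ?_, fun x hx => ?_⟩
  · rintro _ ⟨c, hc, rfl⟩
    exact hPk c hc
  · obtain ⟨c, hc⟩ := Formula.realize_iSup.1 (Formula.realize_imp.1 (h2 fun _ => x) hx)
    exact Set.mem_iUnion₂.2
      ⟨_, ⟨c.1, c.2, rfl⟩, (hN.realize_cosetFormula _ _ _ _).1 hc⟩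

theorem IsModuleModel.isSmall_or_isSmall_of_disjoint (hM : IsModuleModel σ t e M)
    (he : CompleteOrthogonalIdempotents e)
    (hinv : ∀ i r, e i * r = 0 ∨ ∃ s, s * r * e i = e i) (S : Finset ι) (a : M)
    (φ ψ : (lang F).Formula (M ⊕ Fin 1)) (hφψ : ¬ ∃ v, Holds id φ v ∧ Holds id ψ v) :
    IsSmall e S.card (coset e S a ∩ definedSet id φ) ∨
      IsSmall e S.card (coset e S a ∩ definedSet id ψ) := by
  refine ((hM.isEquational he hinv hM.infinite φ).isSmall_inter_or_isSmall_diff he hinv S a).imp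
    id fun h => h.mono fun x hx => ⟨hx.1, fun hx' => hφψ ⟨_, hx', hx.2⟩⟩

/-- In the inductive step a small `φ` is covered in `N` by finitely many cosets. Each `ψ j` is
non-small inside one of them, so two disjoint ones are non-small in the same coset. That coset has
exactly `k` components, contradicting the dichotomy. -/
theorem IsModuleModel.not_isSmall_of_rankGE [Module R V] (hV : IsModuleModel σ t e V)
    (he : CompleteOrthogonalIdempotents e)
    (hinv : ∀ i r, e i * r = 0 ∨ ∃ s, s * r * e i = e i) (k : ℕ)
    (hM : IsModuleModel σ t e M) (hMV : M ⊨ (lang F).completeTheory V)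
    (φ : (lang F).Formula (M ⊕ Fin 1)) (h : RankGE (k : Ordinal.{u}) M φ) :
    ¬ IsSmall e k (definedSet id φ) := by
  induction k generalizing M with
  | zero =>
    rw [Nat.cast_zero, rankGE_zero] at h
    obtain ⟨v, hv⟩ := h
    rintro ⟨P, -, hP, hφ⟩
    obtain ⟨c, hc, -⟩ := Set.mem_iUnion₂.1 (hφ (mem_definedSet.2 hv))
    exact absurd (hP c hc) (Nat.not_lt_zero _)
  | succ k ih =>
    rw [Nat.cast_succ, rankGE_add_one] at h
    obtain ⟨N, _, f, ψ, hψφ, hψ, hdisj⟩ := h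
    intro hsmall
    have hNV : N ⊨ (lang F).completeTheory V := (f.theory_model_iff _).1 hMV
    obtain ⟨_, _, hN⟩ := hV.exists_isModuleModel hNV
    obtain ⟨P, hP, hPk, hφP⟩ := hM.isSmall_of_elementaryEmbedding hN f hsmall
    have hc : ∀ j, ∃ c ∈ P, ¬ IsSmall e k (coset e c.1 c.2 ∩ definedSet id (ψ j)) := fun j => by
      by_contra! hc
      refine ih hN hNV (ψ j) (hψ j) ((isSmall_biUnion hP hc).mono fun x hx => ?_)
      obtain ⟨c, hc, hxc⟩ := Set.mem_iUnion₂.1 (hφP (hψφ j _ hx))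
      exact Set.mem_iUnion₂.2 ⟨c, hc, hxc, hx⟩
    choose c hcP hc using hc
    obtain ⟨i, -, j, -, hij, hcij⟩ := Set.infinite_univ.exists_ne_map_eq_of_mapsTo
      (fun j _ => hcP j) hP
    have hck : (c i).1.card = k := by
      refine le_antisymm (Nat.lt_succ_iff.1 (hPk _ (hcP i))) (not_lt.1 fun hlt => hc i ?_)
      exact (isSmall_coset hlt _).mono Set.inter_subset_left
    have := hN.isSmall_or_isSmall_of_disjoint he hinv (c i).1 (c i).2 (ψ i) (ψ j) (hdisj i j hij)
    rw [hck] at this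
    refine this.elim (hc i) fun h => hc j ?_
    rwa [← hcij]

theorem coset_univ (a : M) : coset e Finset.univ a = Set.univ :=
  Set.eq_univ_of_forall fun _ i hi => absurd (Finset.mem_univ i) hi

/-- A coset for `insert i S` contains infinitely many disjoint cosets for `S`, one for each value of
the `i`-component; no proper elementary extension is needed. -/
theorem IsModuleModel.rankGE_of_coset_subset (hM : IsModuleModel σ t e M)
    (he : CompleteOrthogonalIdempotents e) (S : Finset ι) (a : M)
    (φ : (lang F).Formula (M ⊕ Fin 1)) (h : coset e S a ⊆ definedSet id φ) :
    RankGE (S.card : Ordinal.{u}) M φ := by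
  classical
  induction S using Finset.induction_on generalizing a φ with
  | empty =>
    rw [Finset.card_empty, Nat.cast_zero, rankGE_zero]
    exact ⟨_, h fun _ _ => rfl⟩
  | insert i S hi ih =>
    rw [Finset.card_insert_of_notMem hi, Nat.cast_succ, rankGE_add_one]
    choose b hb using fun j => ((hM.infinite i).natEmbedding _ j).2
    have hmem : ∀ j x, Holds id (cosetFormula t e S (a + e i • b j)) x ↔
        x 0 ∈ coset e S (a + e i • b j) := fun j x => hM.realize_cosetFormula _ _ _ _
    refine ⟨M, inferInstance, ElementaryEmbedding.refl _ _,
      fun j => cosetFormula t e S (a + e i • b j), fun j v hv => ?_, fun j => ?_,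
      fun j l hjl hv => ?_⟩
    · refine mem_definedSet.1 (h fun l hl => ?_)
      rw [Finset.mem_insert, not_or] at hl
      rw [(hmem j v).1 hv l hl.2, smul_add, smul_smul, he.ortho hl.1, zero_smul, add_zero]
    · exact ih _ _ fun x hx => (hmem j _).2 hx
    · obtain ⟨v, hvj, hvl⟩ := hv
      have h1 := ((hmem j v).1 hvj i hi).symm.trans ((hmem l v).1 hvl i hi)
      rw [smul_add, smul_add, smul_smul, smul_smul, (he.idem i).eq] at h1
      refine hjl (((hM.infinite i).natEmbedding _).injective (Subtype.ext ?_))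
      rw [← hb, ← hb]
      exact add_left_cancel h1

end Rank

/-! ### Rank and degree of the theory -/

section Theory

variable [Module R V] {M : Type u} [(lang F).Structure M]

theorem IsModuleModel.not_rankGE (hV : IsModuleModel σ t e V)
    (he : CompleteOrthogonalIdempotents e)
    (hinv : ∀ i r, e i * r = 0 ∨ ∃ s, s * r * e i = e i) (d : Ordinal.{u})
    (hd : ((Fintype.card ι : ℕ) : Ordinal.{u}) < d) (hM : M ⊨ (lang F).completeTheory V)
    (φ : (lang F).Formula (M ⊕ Fin 1)) : ¬ RankGE d M φ := by
  induction d using Ordinal.limitRecOn generalizing M with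
  | zero => exact absurd hd not_lt_zero
  | add_one d ih =>
    intro h
    rcases (Order.lt_add_one_iff.1 hd).eq_or_lt with hd' | hd'
    · rw [← hd', ← Nat.cast_succ] at h
      obtain ⟨_, _, hM'⟩ := hV.exists_isModuleModel hM
      refine hV.not_isSmall_of_rankGE he hinv _ hM' hM φ h ?_
      -- The whole model is one coset for `Finset.univ`, so every subset is `(Fintype.card ι +
      -- 1)`-small.
      exact (isSmall_coset (S := Finset.univ) (Nat.lt_succ_self _) (0 : M)).mono
        (by rw [coset_univ]; exact Set.subset_univ _)
    · rw [rankGE_add_one] at h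
      obtain ⟨N, _, f, ψ, -, hψ, -⟩ := h
      exact ih hd' ((f.theory_model_iff _).1 hM) (ψ 0) (hψ 0)
  | limit d hlim ih =>
    intro h
    rw [rankGE_limit d hlim] at h
    have hd' := hlim.add_one_lt hd
    exact ih _ hd' (Order.lt_add_one_iff.2 le_rfl) hM φ (h _ hd')

theorem IsModuleModel.theoryHasRankAndDegree (hV : IsModuleModel σ t e V)
    (he : CompleteOrthogonalIdempotents e)
    (hinv : ∀ i r, e i * r = 0 ∨ ∃ s, s * r * e i = e i) :
    TheoryHasRankAndDegree ((lang F).completeTheory V) ((Fintype.card ι : ℕ) : Ordinal.{u}) 1 := by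
  intro M _ hM
  have hrank : HasRank M (selfEq (lang F) M) ((Fintype.card ι : ℕ) : Ordinal.{u}) := by
    obtain ⟨_, _, hM'⟩ := hV.exists_isModuleModel hM
    refine ⟨?_, fun d hd => not_lt.1 fun hlt => hV.not_rankGE he hinv d hlt hM _ hd⟩
    exact hM'.rankGE_of_coset_subset he Finset.univ 0 _ fun x _ => Formula.realize_equal.2 rfl
  refine ⟨hrank, ⟨M, inferInstance, ElementaryEmbedding.refl _ _, fun _ => selfEq (lang F) M,
    fun _ => hrank, fun _ _ h => h, fun i j hij => absurd (Subsingleton.elim i j) hij⟩, ?_⟩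
  rintro k ⟨N, _, f, ψ, hψ, -, hdisj⟩
  by_contra! hk
  have hN := (f.theory_model_iff _).1 hM
  obtain ⟨_, _, hN'⟩ := hV.exists_isModuleModel hN
  have hsmall := fun j => hV.not_isSmall_of_rankGE he hinv _ hN' hN (ψ j) (hψ j).1
  -- Of two disjoint definable subsets of the whole model, one is `Fintype.card ι`-small and so
  -- cannot have full rank.
  have h := hN'.isSmall_or_isSmall_of_disjoint he hinv Finset.univ 0
    (ψ ⟨0, zero_lt_one.trans hk⟩) (ψ ⟨1, hk⟩) (hdisj _ _ (by simp))
  rw [coset_univ, Set.univ_inter, Set.univ_inter] at h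
  exact h.elim (hsmall _) (hsmall _)

end Theory

end NearVectorSpace

theorem mainTheorem6 {V : Type u} [AddCommGroup V] (F : Set (AddMonoid.End V))
    (hV : NearVectorSpace.IsNearVectorSpace F) (hF : NearVectorSpace.IsCommutative F)
    (n : ℕ) (hn : (NearVectorSpace.blocks F).encard = n)
    (hinf : ∀ W ∈ NearVectorSpace.blocks F, (W : Set V).Infinite) :
    MorleyRank.TheoryHasRankAndDegree ((NearVectorSpace.lang F).completeTheory V)
      (n : Ordinal.{u}) 1 := by
  obtain ⟨R, _, _, σ, ι, _, e, hσ, hσ1, hgen, he, hinv, hinfe, rfl⟩ :=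
    hV.exists_completeOrthogonalIdempotents hF n hn hinf
  have hM : NearVectorSpace.IsModuleStructure σ V :=
    ⟨fun _ => rfl, fun _ => rfl, fun a v => (hσ a (v 0)).symm⟩
  choose t ht using fun r : R => hM.exists_term hV.neg_one_mem hσ1 hgen r
  exact NearVectorSpace.IsModuleModel.theoryHasRankAndDegree (t := t) ⟨hM, ht, hinfe⟩ he hinv
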